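/- For complex $d\times d$ matrices $B_1,\dots,B_m$ let $$\mu[B_1,\dots,B_m](z)=\Bigl(\prod_{i=1}^m(1-\partial_{z_i})\Bigr)\det\Bigl(z\mathbf I+\sum_{i=1}^m z_iB_i\Bigr)\Big|_{z_1=\dots=z_m=0}\in\mathbb C[z]$$ be their mixed characteristic polynomial. Let $d\ge 1$, let $A_1,\dots,A_m$ be positive semidefinite hermitian $d\times d$ matrices, and let $\varepsilon_i\in\{1,-1\}$ for $i=1,\dots,m$. Then the product $$\mu[\varepsilon_1A_1,\dots,\varepsilon_mA_m]\cdot\mu[-\varepsilon_1A_1,\dots,-\varepsilon_mA_m]$$ is a nonzero polynomial all of whose complex roots are real, it has a largest root $r$, and $$\Bigl\|\sum_{i=1}^m\varepsilon_iA_i\Bigr\|\le r,$$ where $\|\cdot\|$ is the operator norm induced by the Euclidean norm on $\mathbb C^d$. In particular, every eigenvalue of $\sum_{i=1}^m\varepsilon_iA_i$ lies in $[-r,r]$. -/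

import Mathlib

open scoped Polynomial ComplexOrder

/-- The determinantal polynomial `det (z I + ∑ i, z_i A_i)`, as a polynomial in the variables
`z_1, …, z_m` with coefficients in `ℂ[z]`. -/
noncomputable def determinantalPoly {m d : ℕ} (A : Fin m → Matrix (Fin d) (Fin d) ℂ) :
    MvPolynomial (Fin m) ℂ[X] :=
  Matrix.det
    ((MvPolynomial.C Polynomial.X : MvPolynomial (Fin m) ℂ[X]) •
        (1 : Matrix (Fin d) (Fin d) (MvPolynomial (Fin m) ℂ[X])) +
      ∑ i, (MvPolynomial.X i : MvPolynomial (Fin m) ℂ[X]) •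
        (A i).map (fun a => MvPolynomial.C (Polynomial.C a)))

/-- The differential operator `∏ i, (1 - ∂_{z_i})` on polynomials in `z_1, …, z_m` over `ℂ[z]`.
The product is composition; the factors commute, so that their order is immaterial. -/
noncomputable def oneSubPderivProd (m : ℕ) :
    Module.End ℂ[X] (MvPolynomial (Fin m) ℂ[X]) :=
  (List.ofFn fun i : Fin m =>
    (1 : Module.End ℂ[X] (MvPolynomial (Fin m) ℂ[X])) -
      (MvPolynomial.pderiv i).toLinearMap).prod

/-- The mixed characteristic polynomial `μ[A_1, …, A_m] ∈ ℂ[z]`: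
`(∏ i, (1 - ∂_{z_i})) det (z I + ∑ i, z_i A_i)` evaluated at `z_1 = ⋯ = z_m = 0`. -/
noncomputable def mixedCharPoly {m d : ℕ} (A : Fin m → Matrix (Fin d) (Fin d) ℂ) : ℂ[X] :=
  MvPolynomial.eval (fun _ => 0) (oneSubPderivProd m (determinantalPoly A))

/-- `r` is the largest root of the real-rooted polynomial `p`: `p` is not the zero polynomial, all
its complex roots are real and at most `r`, and `r` is one of them. -/
def IsMaxRoot (p : ℂ[X]) (r : ℝ) : Prop :=
  p ≠ 0 ∧ p.IsRoot (r : ℂ) ∧ ∀ z : ℂ, p.IsRoot z → z.im = 0 ∧ z.re ≤ r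

/-! Let P(z, x) = det(zI + Σ xᵢεᵢAᵢ). It has real coefficients and no zero with Im z > 0 and all εᵢ
Im xᵢ ≥ 0. Its x-free part is monic of degree d in z, and every other x-monomial has a coefficient
of smaller degree. Each operator 1 - ∂ᵢ preserves these properties. Applying all of them and setting
x = 0 gives μ, while x = (-1, …, -1) gives the characteristic polynomial of S = Σ εᵢAᵢ. So it
suffices to exchange, one variable at a time, "apply 1 - ∂ᵢ and set xᵢ = 0" for "set xᵢ = -1"
without moving the largest real root to the right (`Bivariate.Stable.evalEval_neg_one_ne_zero`). The
signs ε and -ε then bound the two ends of the spectrum of S.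

For the exchange, fix the other variables at real values, which leaves Φ(z, t), and let e be the
sign of the variable t. Suppose F = Φ - ∂ₜΦ has no zero with z > r, t = 0. The function e ∂ₜF/F of z
maps the upper half plane to the closed lower one and vanishes at infinity, so it is nonnegative to
the right of its poles. Hence F can only grow as t leaves 0 in the direction e, and it stays
positive for z > r (`Bivariate.Stable.evalEval_pos`). For such z the polynomial g = Φ(z, ·) is
real-rooted with g - g' > 0 on that ray. Then g(-1) = 0 is impossible: the monotonicity of exp(-t)
g(t) locates the roots, and the logarithmic derivative at 0 has the wrong size or sign. -/

/-! ### Univariate polynomials: half planes, logarithmic derivatives, real roots -/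

open Polynomial in
/-- At a point of a closed half plane free of roots, the logarithmic derivative points to the
opposite open half plane, unless it vanishes. -/
theorem im_logDeriv_neg_or_eq_zero {f : ℂ[X]} {e : ℝ} (hf : ∀ t : ℂ, 0 ≤ e * t.im → f.eval t ≠ 0)
    {t : ℂ} (ht : 0 ≤ e * t.im) :
    e * (f.derivative.eval t / f.eval t).im < 0 ∨ f.derivative.eval t / f.eval t = 0 := by
  rw [(IsAlgClosed.splits f).eval_derivative_div_eval_of_ne_zero (hf t ht)]
  have key : ∀ s : Multiset ℂ, (∀ ρ ∈ s, e * ρ.im < 0) →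
      e * (s.map fun ρ => 1 / (t - ρ)).sum.im < 0 ∨ (s.map fun ρ => 1 / (t - ρ)).sum = 0 := by
    intro s
    induction s using Multiset.induction_on with
    | empty => simp
    | cons ρ s ih =>
      intro hs
      left
      have h1 : e * ρ.im < 0 := hs ρ (by simp)
      have h2 : e * (1 / (t - ρ)).im < 0 := by
        have hne : t - ρ ≠ 0 := by
          rintro h
          rw [sub_eq_zero] at h
          subst h
          linarith
        have hpos := Complex.normSq_pos.mpr hne
        rw [one_div, Complex.inv_im, Complex.sub_im, mul_div_assoc']
        apply div_neg_of_neg_of_pos _ hpos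
        linarith
      have h3 := ih (fun ρ' h => hs ρ' (by simp [h]))
      simp only [Multiset.map_cons, Multiset.sum_cons, Complex.add_im, mul_add]
      rcases h3 with h3 | h3
      · linarith
      · rw [h3]
        simpa using h2
  refine key _ fun ρ hρ => ?_
  by_contra h
  exact hf ρ (not_lt.mp h) (isRoot_of_mem_roots hρ)

open Polynomial in
-- A zero would force f'/f = 1, which is real and nonzero, against `im_logDeriv_neg_or_eq_zero`.
theorem eval_sub_derivative_ne_zero {f : ℂ[X]} {e : ℝ} (hf : ∀ t : ℂ, 0 ≤ e * t.im → f.eval t ≠ 0)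
    {t : ℂ} (ht : 0 ≤ e * t.im) : (f - derivative f).eval t ≠ 0 := by
  intro h
  have h0 := hf t ht
  have h1 : f.derivative.eval t / f.eval t = 1 := by
    rw [eval_sub, sub_eq_zero] at h
    rw [← h, div_self h0]
  rcases im_logDeriv_neg_or_eq_zero hf ht with h2 | h2 <;> simp [h1] at h2

open Polynomial in
/-- A polynomial whose roots lie in a half plane is comparable at two points, one of which lies
inside the opposite half plane. -/
theorem norm_eval_le_of_halfPlane {f : ℂ[X]} {e : ℝ} (hf : ∀ t : ℂ, 0 ≤ e * t.im → f.eval t ≠ 0)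
    {x₀ x₁ : ℂ} (hx : 0 < e * x₀.im) {N : ℕ} (hN : f.natDegree ≤ N) :
    ‖f.eval x₁‖ ≤ (1 + ‖x₁ - x₀‖ / |x₀.im|) ^ N * ‖f.eval x₀‖ := by
  have him : 0 < |x₀.im| := abs_pos.mpr (by rintro h; simp [h] at hx)
  set K := 1 + ‖x₁ - x₀‖ / |x₀.im| with hK
  have hK1 : 1 ≤ K := by
    have : 0 ≤ ‖x₁ - x₀‖ / |x₀.im| := by positivity
    linarith
  have key : ∀ s : Multiset ℂ, (∀ ρ ∈ s, e * ρ.im < 0) →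
      ‖(s.map fun ρ => x₁ - ρ).prod‖ ≤ K ^ Multiset.card s * ‖(s.map fun ρ => x₀ - ρ).prod‖ := by
    intro s
    induction s using Multiset.induction_on with
    | empty => simp
    | cons ρ s ih =>
      intro hs
      have h1 : e * ρ.im < 0 := hs ρ (by simp)
      have h3 := ih (fun ρ' h => hs ρ' (by simp [h]))
      -- The root and x₀ lie on opposite sides of the real axis. This lower bound makes K a bound
      -- for the ratio of the factors at x₁ and x₀.
      have h4 : |x₀.im| ≤ ‖x₀ - ρ‖ := by
        refine le_trans ?_ (Complex.abs_im_le_norm _)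
        rw [Complex.sub_im]
        rcases lt_trichotomy e 0 with he | he | he
        · have ha : x₀.im < 0 := by nlinarith
          have hb : 0 < ρ.im := by nlinarith
          rw [abs_of_neg ha, abs_of_neg (by linarith)]
          linarith
        · simp [he] at hx
        · have ha : 0 < x₀.im := by nlinarith
          have hb : ρ.im < 0 := by nlinarith
          rw [abs_of_pos ha, abs_of_pos (by linarith)]
          linarith
      have h5 : ‖x₁ - ρ‖ ≤ K * ‖x₀ - ρ‖ := by
        have h6 : ‖x₁ - ρ‖ ≤ ‖x₁ - x₀‖ + ‖x₀ - ρ‖ := by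
          simpa using norm_add_le (x₁ - x₀) (x₀ - ρ)
        have h7 : ‖x₁ - x₀‖ ≤ ‖x₁ - x₀‖ / |x₀.im| * ‖x₀ - ρ‖ := by
          rw [div_mul_eq_mul_div, le_div_iff₀ him]
          gcongr
        rw [hK, add_mul, one_mul]
        linarith
      simp only [Multiset.map_cons, Multiset.prod_cons, Multiset.card_cons, norm_mul]
      calc ‖x₁ - ρ‖ * ‖(s.map fun ρ => x₁ - ρ).prod‖
          ≤ (K * ‖x₀ - ρ‖) * (K ^ Multiset.card s * ‖(s.map fun ρ => x₀ - ρ).prod‖) := by gcongr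
        _ = _ := by ring
  have h := key f.roots fun ρ hρ => by
    by_contra h
    exact hf ρ (not_lt.mp h) (isRoot_of_mem_roots hρ)
  have hs := IsAlgClosed.splits f
  rw [hs.eval_eq_prod_roots x₁, hs.eval_eq_prod_roots x₀, norm_mul, norm_mul]
  have hcard : K ^ Multiset.card f.roots ≤ K ^ N :=
    pow_le_pow_right₀ hK1 ((card_roots' f).trans hN)
  calc _ ≤ ‖f.leadingCoeff‖ * (K ^ N * ‖(f.roots.map fun ρ => x₀ - ρ).prod‖) := by
        gcongr
        refine h.trans ?_
        gcongr
    _ = _ := by ring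

open Polynomial in
theorem splits_of_forall_aeval_ne_zero {g : ℝ[X]} (h : ∀ z : ℂ, z.im ≠ 0 → aeval z g ≠ 0) :
    g.Splits := by
  refine Splits.of_splits_map_of_injective (i := algebraMap ℝ ℂ) Complex.ofReal_injective
    (IsAlgClosed.splits _) fun a ha => ?_
  have h1 : aeval a g = 0 := by
    have := isRoot_of_mem_roots ha
    rwa [IsRoot, eval_map_algebraMap] at this
  by_cases him : a.im = 0
  · exact ⟨a.re, Complex.ext (by simp) (by simp [him])⟩
  · exact absurd h1 (h a him)

open Polynomial in
theorem hasDerivAt_exp_neg_mul_eval (g : ℝ[X]) (t : ℝ) :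
    HasDerivAt (fun t => Real.exp (-t) * g.eval t) (-(Real.exp (-t) * (g - derivative g).eval t))
      t := by
  have h := ((hasDerivAt_id t).neg.exp).mul (g.hasDerivAt t)
  refine h.congr_deriv ?_
  simp
  ring

open Polynomial in
-- The function exp(-t) g(t) decreases strictly to 0 on [0, ∞), so g > 0 there and all roots are
-- negative. Then g'(0)/g(0) = Σ 1/(-ρ) has positive terms, and a root -1 alone would contribute 1,
-- whereas g(0) > g'(0) makes the sum less than 1.
theorem eval_neg_one_ne_zero_of_pos_right {g : ℝ[X]} (hg : g.Splits)
    (hpos : ∀ t, 0 ≤ t → 0 < (g - derivative g).eval t) : g.eval (-1) ≠ 0 := by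
  have hanti : StrictAntiOn (fun t => Real.exp (-t) * g.eval t) (Set.Ici 0) := by
    apply strictAntiOn_of_deriv_neg (convex_Ici 0) (by fun_prop)
    intro t ht
    rw [interior_Ici] at ht
    rw [(hasDerivAt_exp_neg_mul_eval g t).deriv]
    have := mul_pos (Real.exp_pos (-t)) (hpos t ht.le)
    linarith
  have hlim : Filter.Tendsto (fun t => Real.exp (-t) * g.eval t) Filter.atTop (nhds 0) := by
    refine (tendsto_div_exp_atTop g).congr fun t => ?_
    rw [Real.exp_neg, div_eq_mul_inv, mul_comm]
  have hgpos : ∀ t, 0 ≤ t → 0 < g.eval t := by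
    intro t ht
    -- The limit gives only a weak inequality; the passage from t to t + 1 makes it strict.
    have h1 : 0 ≤ Real.exp (-(t + 1)) * g.eval (t + 1) := by
      refine le_of_tendsto hlim ?_
      filter_upwards [Filter.eventually_ge_atTop (t + 1)] with s hs
      exact hanti.antitoneOn (Set.mem_Ici.mpr (by linarith)) (Set.mem_Ici.mpr (by linarith)) hs
    have h2 := hanti (Set.mem_Ici.mpr ht) (Set.mem_Ici.mpr (by linarith : 0 ≤ t + 1))
      (lt_add_one t)
    exact pos_of_mul_pos_right (h1.trans_lt h2) (Real.exp_pos _).le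
  intro hroot
  have h0 := hgpos 0 le_rfl
  have hF := hpos 0 le_rfl
  have hsum := hg.eval_derivative_div_eval_of_ne_zero h0.ne'
  have hlt : g.derivative.eval 0 / g.eval 0 < 1 := by
    rw [div_lt_one h0]
    simpa using hF
  have hg0 : g ≠ 0 := by rintro rfl; simp at h0
  have hmem : (1 : ℝ) ∈ g.roots.map fun ρ => 1 / (0 - ρ) :=
    Multiset.mem_map.mpr ⟨-1, by simp [hg0, hroot], by norm_num⟩
  have hle : 1 ≤ (g.roots.map fun ρ => 1 / (0 - ρ)).sum := by
    refine Multiset.single_le_sum ?_ _ hmem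
    intro x hx
    obtain ⟨ρ, hρ, rfl⟩ := Multiset.mem_map.mp hx
    have : ρ < 0 := by
      by_contra h
      exact (hgpos ρ (not_lt.mp h)).ne' (isRoot_of_mem_roots hρ)
    apply one_div_nonneg.mpr
    linarith
  linarith

open Polynomial in
-- Here exp(-t) g(t) decreases strictly on (-∞, 0], so a root -1 is the only root there and g(0) <
-- 0. Write g = (t + 1)h. Positivity of g - g' at 0 gives h'(0) < 0, and at -1 it gives h(-1) ≠ 0.
-- So all roots of h are positive and h'(0)/h(0) ≤ 0, although h(0) and h'(0) are both negative.
theorem eval_neg_one_ne_zero_of_pos_left {g : ℝ[X]} (hg : g.Splits)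
    (hpos : ∀ t, t ≤ 0 → 0 < (g - derivative g).eval t) : g.eval (-1) ≠ 0 := by
  have hanti : StrictAntiOn (fun t => Real.exp (-t) * g.eval t) (Set.Iic 0) := by
    apply strictAntiOn_of_deriv_neg (convex_Iic 0) (by fun_prop)
    intro t ht
    rw [interior_Iic] at ht
    rw [(hasDerivAt_exp_neg_mul_eval g t).deriv]
    have := mul_pos (Real.exp_pos (-t)) (hpos t (Set.mem_Iio.mp ht).le)
    linarith
  intro hroot
  have huniq : ∀ t ≤ 0, g.eval t = 0 → t = -1 := by
    intro t ht h
    refine hanti.injOn (Set.mem_Iic.mpr ht) (Set.mem_Iic.mpr (by norm_num)) ?_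
    simp [h, hroot]
  have hg0neg : g.eval 0 < 0 := by
    have := hanti (Set.mem_Iic.mpr (by norm_num : (-1 : ℝ) ≤ 0)) (Set.mem_Iic.mpr le_rfl)
      (by norm_num)
    simpa [hroot] using this
  have hg0 : g ≠ 0 := by rintro rfl; simp at hg0neg
  obtain ⟨h, rfl⟩ := dvd_iff_isRoot.mpr (show g.IsRoot (-1) from hroot)
  have hsplit : h.Splits := hg.of_dvd hg0 (dvd_mul_left _ _)
  have h0 : h.eval 0 < 0 := by simpa using hg0neg
  have hder : ∀ t, ((X - C (-1)) * h - derivative ((X - C (-1)) * h)).eval t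
      = (t + 1) * h.eval t - (h.eval t + (t + 1) * h.derivative.eval t) := by
    intro t
    simp
  have h0' : h.derivative.eval 0 < 0 := by
    have := hpos 0 le_rfl
    rw [hder] at this
    linarith
  have h1 : h.eval (-1) ≠ 0 := by
    intro h1
    have := hpos (-1) (by norm_num)
    rw [hder, h1] at this
    norm_num at this
  have hsum := hsplit.eval_derivative_div_eval_of_ne_zero h0.ne
  have hle : (h.roots.map fun ρ => 1 / (0 - ρ)).sum ≤ 0 := by
    refine Multiset.sum_induction (fun x => x ≤ 0) _ (fun _ _ => add_nonpos) le_rfl fun x hx => ?_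
    obtain ⟨ρ, hρ, rfl⟩ := Multiset.mem_map.mp hx
    have hρ0 : h.eval ρ = 0 := isRoot_of_mem_roots hρ
    have : 0 < ρ := by
      by_contra hneg
      have := huniq ρ (not_lt.mp hneg) (by simp [hρ0])
      exact h1 (this ▸ hρ0)
    apply one_div_nonpos.mpr
    linarith
  have := div_pos_of_neg_of_neg h0' h0
  linarith

open Polynomial in
theorem eventually_eval_pos_of_monic {p : ℝ[X]} (hp : p.Monic) :
    ∀ᶠ z in Filter.atTop, 0 < p.eval z := by
  rcases lt_or_ge 0 p.degree with h | h
  · exact (p.tendsto_atTop_of_leadingCoeff_nonneg h (by simp [hp.leadingCoeff])).eventually_gt_atTop 0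
  · have h1 : p = 1 := (hp.degree_le_zero_iff_eq_one).mp h
    simp [h1]

open Polynomial in
theorem eval_pos_of_monic_of_ne_zero {p : ℝ[X]} (hp : p.Monic) {r : ℝ}
    (h : ∀ z, r < z → p.eval z ≠ 0) {z : ℝ} (hz : r < z) : 0 < p.eval z := by
  by_contra hneg
  obtain ⟨w, hw, hzw⟩ :=
    ((eventually_eval_pos_of_monic hp).and (Filter.eventually_ge_atTop z)).exists
  obtain ⟨c, hc, hc0⟩ := intermediate_value_Icc hzw p.continuous.continuousOn
    (Set.mem_Icc.mpr ⟨not_lt.mp hneg, hw.le⟩)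
  exact h c (hz.trans_le hc.1) hc0

/-- The right derivative of a function that is nonpositive to the right of one of its zeros. -/
theorem HasDerivAt.nonpos_of_nonpos_right {g : ℝ → ℝ} {c : ℝ} (hg : HasDerivAt g c 0)
    (h0 : g 0 = 0) (h : ∀ y, 0 < y → g y ≤ 0) : c ≤ 0 := by
  refine le_of_tendsto hg.tendsto_slope_zero_right ?_
  filter_upwards [self_mem_nhdsWithin] with y hy
  have hy : 0 < y := hy
  rw [zero_add, h0, sub_zero, smul_eq_mul]
  exact mul_nonpos_of_nonneg_of_nonpos (inv_nonneg.mpr hy.le) (h y hy)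

open Polynomial in
/-- A real rational function that vanishes at infinity and maps the upper half plane to the lower
one is nonnegative to the right of its poles. -/
theorem div_nonneg_of_im_nonpos {N D : ℝ[X]} (hdeg : N.degree < D.degree)
    (hND : ∀ z : ℂ, 0 < z.im → (aeval z N / aeval z D).im ≤ 0) {a : ℝ}
    (hD : ∀ z, a ≤ z → D.eval z ≠ 0) {z : ℝ} (hz : a ≤ z) : 0 ≤ N.eval z / D.eval z := by
  have hder : ∀ x, a ≤ x → HasDerivAt (fun x => N.eval x / D.eval x)
      ((N.derivative.eval x * D.eval x - N.eval x * D.derivative.eval x) / D.eval x ^ 2) x :=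
    fun x hx => (N.hasDerivAt x).div (D.hasDerivAt x) (hD x hx)
  have hanti : AntitoneOn (fun x => N.eval x / D.eval x) (Set.Ici a) := by
    apply antitoneOn_of_deriv_nonpos (convex_Ici a)
    · exact fun x hx => (hder x hx).continuousAt.continuousWithinAt
    · intro x hx
      rw [interior_Ici] at hx
      exact (hder x (Set.mem_Ioi.mp hx).le).differentiableAt.differentiableWithinAt
    intro x hx
    rw [interior_Ici] at hx
    have hx : a ≤ x := (Set.mem_Ioi.mp hx).le
    rw [(hder x hx).deriv]
    set c := (N.derivative.eval x * D.eval x - N.eval x * D.derivative.eval x) / D.eval x ^ 2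
      with hc
    have hofReal : ∀ p : ℝ[X], aeval (x : ℂ) p = ((p.eval x : ℝ) : ℂ) := fun p => by
      simpa using (aeval_algebraMap_apply ℂ x p)
    have hDx : aeval (x : ℂ) D ≠ 0 := by
      rw [hofReal]
      exact_mod_cast hD x hx
    -- The real derivative c is read off vertically: Im (N/D)(x + iy) has derivative c at y = 0,
    -- vanishes there and is nonpositive for y > 0.
    have h1 : HasDerivAt (fun w : ℂ => aeval w N / aeval w D) (c : ℂ) (x : ℂ) := by
      refine ((N.hasDerivAt_aeval (x : ℂ)).div (D.hasDerivAt_aeval (x : ℂ)) hDx).congr_deriv ?_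
      simp only [hofReal, hc]
      push_cast
      rfl
    have h2 : HasDerivAt (fun y : ℝ => (x : ℂ) + y * Complex.I) Complex.I 0 := by
      have := ((hasDerivAt_id (0 : ℝ)).ofReal_comp.mul_const Complex.I).const_add (x : ℂ)
      simpa using this
    have h3 : HasDerivAt (fun y : ℝ => aeval ((x : ℂ) + y * Complex.I) N /
        aeval ((x : ℂ) + y * Complex.I) D) (c * Complex.I) 0 := by
      have h1' : HasDerivAt (fun w : ℂ => aeval w N / aeval w D) (c : ℂ)
          ((x : ℂ) + ((0 : ℝ) : ℂ) * Complex.I) := by simpa using h1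
      exact h1'.comp (0 : ℝ) h2
    have h4 := Complex.imCLM.hasFDerivAt.comp_hasDerivAt (0 : ℝ) h3
    have h5 : Complex.imCLM ((c : ℂ) * Complex.I) = c := by simp
    rw [h5] at h4
    refine h4.nonpos_of_nonpos_right ?_ fun y hy => ?_
    · simp only [Function.comp_apply, Complex.ofReal_zero, zero_mul, add_zero, hofReal]
      rw [← Complex.ofReal_div]
      simp
    · exact hND _ (by simpa using hy)
  have hlim := div_tendsto_atTop_zero_of_degree_lt N D hdeg
  refine le_of_tendsto hlim ?_
  filter_upwards [Filter.eventually_ge_atTop z] with w hw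
  exact hanti (Set.mem_Ici.mpr hz) (Set.mem_Ici.mpr (hz.trans hw)) hw

open Polynomial in
theorem degree_C_mul_le_degree (a : ℝ) (p : ℝ[X]) : (C a * p).degree ≤ p.degree := by
  rw [← smul_eq_C_mul]
  exact degree_smul_le a p

/-! ### Bivariate stable polynomials: exchanging one operator for a shift -/

namespace Bivariate

open Polynomial

/-- The specialization of the inner variable of a bivariate real polynomial to a complex number. -/
noncomputable def slice (z : ℂ) : ℝ[X][X] →+* ℂ[X] :=
  mapRingHom (aeval z : ℝ[X] →ₐ[ℝ] ℂ).toRingHom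

theorem slice_derivative (z : ℂ) (Φ : ℝ[X][X]) :
    slice z (derivative Φ) = derivative (slice z Φ) := by
  simp [slice, derivative_map]

theorem slice_ofReal (z : ℝ) (Φ : ℝ[X][X]) :
    slice z Φ = (Φ.map (evalRingHom z)).map (algebraMap ℝ ℂ) := by
  rw [slice, coe_mapRingHom, Polynomial.map_map]
  congr 1
  ext <;> simp

theorem aeval_eval_C (z : ℂ) (t : ℝ) (Φ : ℝ[X][X]) :
    aeval z (Φ.eval (C t)) = (slice z Φ).eval (t : ℂ) := by
  induction Φ using Polynomial.induction_on' with
  | add p q hp hq => simp [hp, hq]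
  | monomial n a => simp [slice]

theorem continuous_eval_slice (Φ : ℝ[X][X]) (t : ℂ) :
    Continuous fun z => (slice z Φ).eval t := by
  induction Φ using Polynomial.induction_on' with
  | add p q hp hq =>
    simp only [map_add, eval_add]
    exact hp.add hq
  | monomial n a =>
    simp only [slice, coe_mapRingHom, map_monomial, eval_monomial]
    exact a.continuous_aeval.mul continuous_const

theorem continuous_evalEval (Φ : ℝ[X][X]) : Continuous fun p : ℝ × ℝ => evalEval p.1 p.2 Φ := by
  induction Φ using Polynomial.induction_on' with
  | add p q hp hq =>
    simp only [evalEval_add]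
    exact hp.add hq
  | monomial n a =>
    simp only [evalEval, eval_monomial, eval_mul, eval_pow, eval_C]
    exact (a.continuous.comp continuous_fst).mul (continuous_snd.pow n)

/-- A bivariate polynomial without zeros where the inner variable is in the open upper half plane
and the outer one in the closed half plane given by the sign of `e`. -/
def Stable (e : ℝ) (Φ : ℝ[X][X]) : Prop :=
  ∀ z : ℂ, 0 < z.im → ∀ t : ℂ, 0 ≤ e * t.im → (slice z Φ).eval t ≠ 0

/-- Monic in the inner variable, uniformly in the outer one. -/
def InnerMonic (Φ : ℝ[X][X]) : Prop :=
  (Φ.coeff 0).Monic ∧ ∀ j, j ≠ 0 → (Φ.coeff j).degree < (Φ.coeff 0).degree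

theorem Stable.sub_derivative {e : ℝ} {Φ : ℝ[X][X]} (h : Stable e Φ) :
    Stable e (Φ - derivative Φ) := by
  intro z hz t ht
  rw [map_sub, slice_derivative]
  exact eval_sub_derivative_ne_zero (h z hz) ht

theorem degree_coeff_derivative_lt {Φ : ℝ[X][X]} (h : InnerMonic Φ) (j : ℕ) :
    ((derivative Φ).coeff j).degree < (Φ.coeff 0).degree := by
  rw [coeff_derivative]
  refine lt_of_le_of_lt ?_ (h.2 (j + 1) (Nat.succ_ne_zero j))
  have : ((j : ℝ[X]) + 1) = C ((j : ℝ) + 1) := by simp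
  rw [this, mul_comm]
  exact degree_C_mul_le_degree _ _

theorem InnerMonic.sub_derivative {Φ : ℝ[X][X]} (h : InnerMonic Φ) :
    InnerMonic (Φ - derivative Φ) := by
  have h0 : (Φ - derivative Φ).coeff 0 = Φ.coeff 0 - (derivative Φ).coeff 0 := coeff_sub _ _ _
  have hd := degree_sub_eq_left_of_degree_lt (degree_coeff_derivative_lt h 0)
  refine ⟨?_, fun j hj => ?_⟩
  · rw [h0]
    exact h.1.sub_of_left (degree_coeff_derivative_lt h 0)
  · rw [h0, hd, coeff_sub]
    exact (degree_sub_le _ _).trans_lt (max_lt (h.2 j hj) (degree_coeff_derivative_lt h j))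

theorem InnerMonic.eval_C {Φ : ℝ[X][X]} (h : InnerMonic Φ) (t : ℝ) :
    (Φ.eval (C t)).Monic ∧ (Φ.eval (C t)).degree = (Φ.coeff 0).degree := by
  have hlt : (∑ j ∈ Finset.range Φ.natDegree, Φ.coeff (j + 1) * C t ^ (j + 1)).degree <
      (Φ.coeff 0).degree := by
    refine (degree_sum_le _ _).trans_lt ?_
    rw [Finset.sup_lt_iff (bot_lt_iff_ne_bot.mpr (by simpa using h.1.ne_zero))]
    intro j _
    rw [← C_pow, mul_comm]
    exact (degree_C_mul_le_degree _ _).trans_lt (h.2 _ (Nat.succ_ne_zero j))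
  rw [eval_eq_sum_range, Finset.sum_range_succ']
  simp only [pow_zero, mul_one]
  exact ⟨h.1.add_of_right hlt, degree_add_eq_right_of_degree_lt hlt⟩

theorem degree_eval_C_derivative_lt {Φ : ℝ[X][X]} (h : InnerMonic Φ) (t : ℝ) :
    ((derivative Φ).eval (C t)).degree < (Φ.coeff 0).degree := by
  rw [eval_eq_sum_range]
  refine (degree_sum_le _ _).trans_lt ?_
  rw [Finset.sup_lt_iff (bot_lt_iff_ne_bot.mpr (by simpa using h.1.ne_zero))]
  intro j _
  rw [← C_pow, mul_comm]
  exact (degree_C_mul_le_degree _ _).trans_lt (degree_coeff_derivative_lt h j)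

/-- After division by the constant coefficient, the other terms tend to 0 as z → ∞, uniformly in |t|
≤ T. This keeps roots from entering from infinity in `Stable.evalEval_pos`. -/
theorem exists_forall_evalEval_pos {Φ : ℝ[X][X]} (h : InnerMonic Φ) (T : ℝ) :
    ∃ M, ∀ z, M ≤ z → ∀ t, |t| ≤ T → 0 < evalEval z t Φ := by
  have hlim : Filter.Tendsto (fun z : ℝ => ∑ j ∈ Finset.range Φ.natDegree,
      |(Φ.coeff (j + 1)).eval z / (Φ.coeff 0).eval z| * T ^ (j + 1)) Filter.atTop (nhds 0) := by
    have : (0 : ℝ) = ∑ j ∈ Finset.range Φ.natDegree, |(0 : ℝ)| * T ^ (j + 1) := by simp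
    rw [this]
    refine tendsto_finsetSum _ fun j _ => Filter.Tendsto.mul_const _ (Filter.Tendsto.abs ?_)
    exact div_tendsto_atTop_zero_of_degree_lt _ _ (h.2 _ (Nat.succ_ne_zero j))
  obtain ⟨M, hM⟩ := Filter.eventually_atTop.mp
    ((eventually_eval_pos_of_monic h.1).and (hlim.eventually_lt_const one_pos))
  refine ⟨M, fun z hz t ht => ?_⟩
  obtain ⟨h0, h1⟩ := hM z hz
  have hsum : evalEval z t Φ = (Φ.coeff 0).eval z * (1 + ∑ j ∈ Finset.range Φ.natDegree,
      (Φ.coeff (j + 1)).eval z / (Φ.coeff 0).eval z * t ^ (j + 1)) := by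
    rw [evalEval, eval_eq_sum_range (p := Φ), Finset.sum_range_succ', mul_add, Finset.mul_sum]
    simp only [eval_add, eval_finsetSum, eval_mul, eval_pow, eval_C, pow_zero, mul_one]
    rw [add_comm]
    refine congrArg _ ?_
    refine Finset.sum_congr rfl fun j _ => ?_
    field_simp
  rw [hsum]
  refine mul_pos h0 ?_
  have habs : |∑ j ∈ Finset.range Φ.natDegree,
      (Φ.coeff (j + 1)).eval z / (Φ.coeff 0).eval z * t ^ (j + 1)| < 1 := by
    refine (Finset.abs_sum_le_sum_abs _ _).trans_lt (lt_of_le_of_lt ?_ h1)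
    refine Finset.sum_le_sum fun j _ => ?_
    rw [abs_mul, abs_pow]
    gcongr
  linarith [(abs_lt.mp habs).1]

/-- For real t, stability sends the upper half plane to the closed lower one under e ∂ₜΦ/Φ, and
inner monicity makes this quotient vanish at infinity, so `div_nonneg_of_im_nonpos` applies. -/
theorem Stable.mul_div_nonneg {e : ℝ} {Φ : ℝ[X][X]} (hs : Stable e Φ) (hm : InnerMonic Φ)
    (t : ℝ) {a : ℝ} (h : ∀ z, a ≤ z → 0 < evalEval z t Φ) {z : ℝ} (hz : a ≤ z) :
    0 ≤ e * evalEval z t (derivative Φ) := by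
  have key := div_nonneg_of_im_nonpos (N := C e * (derivative Φ).eval (C t)) (D := Φ.eval (C t))
    ?_ ?_ (fun z hz => (h z hz).ne') hz
  · rw [eval_mul, eval_C] at key
    have hD : 0 < (Φ.eval (C t)).eval z := h z hz
    rw [div_nonneg_iff] at key
    rcases key with key | key
    · exact key.1
    · exact absurd key.2 (not_le.mpr hD)
  · rw [(hm.eval_C t).2]
    exact (degree_C_mul_le_degree _ _).trans_lt (degree_eval_C_derivative_lt hm t)
  · intro w hw
    rw [map_mul, aeval_C, aeval_eval_C, aeval_eval_C, slice_derivative, mul_div_assoc,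
      Complex.coe_algebraMap, Complex.im_ofReal_mul]
    rcases im_logDeriv_neg_or_eq_zero (hs w hw) (t := t) (by simp) with h1 | h1
    · exact h1.le
    · simp [h1]

/-- Continuity argument in s: as long as Φ(·, es) is positive to the right of z₀, its s-derivative
is nonnegative there, so positivity cannot be lost. -/
theorem Stable.evalEval_pos {e : ℝ} {Φ : ℝ[X][X]} (hs : Stable e Φ) (hm : InnerMonic Φ)
    {r : ℝ} (h : ∀ z, r < z → evalEval z 0 Φ ≠ 0) {z₀ : ℝ} (hz₀ : r < z₀) {s₀ : ℝ}
    (hs₀ : 0 ≤ s₀) : 0 < evalEval z₀ (e * s₀) Φ := by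
  have hinit : ∀ z, r < z → 0 < evalEval z 0 Φ := by
    intro z hz
    refine eval_pos_of_monic_of_ne_zero ?_ h hz
    simpa using (hm.eval_C 0).1
  by_contra hneg
  obtain ⟨M, hM⟩ := exists_forall_evalEval_pos hm (|e| * s₀)
  have habs : ∀ s, 0 ≤ s → s ≤ s₀ → |e * s| ≤ |e| * s₀ := by
    intro s h0 h1
    rw [abs_mul, abs_of_nonneg h0]
    gcongr
  have hcont : Continuous fun p : ℝ × ℝ => evalEval p.1 (e * p.2) Φ :=
    (continuous_evalEval Φ).comp (continuous_fst.prodMk (continuous_const.mul continuous_snd))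
  have hK : IsCompact (Set.Icc z₀ M ×ˢ Set.Icc 0 s₀ ∩
      {p : ℝ × ℝ | evalEval p.1 (e * p.2) Φ ≤ 0}) :=
    (isCompact_Icc.prod isCompact_Icc).inter_right (isClosed_le hcont continuous_const)
  have hz₀M : z₀ ≤ M := by
    by_contra hlt
    exact hneg (hM z₀ (not_le.mp hlt).le _ (habs s₀ hs₀ le_rfl))
  -- First contact: a point with least s where positivity fails. The cutoff M makes the set of such
  -- points compact.
  obtain ⟨⟨z, s⟩, ⟨⟨hz, hs'⟩, hle⟩, hmin⟩ := hK.exists_isMinOn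
    ⟨(z₀, s₀), ⟨⟨⟨le_rfl, hz₀M⟩, ⟨hs₀, le_rfl⟩⟩, not_lt.mp hneg⟩⟩ continuous_snd.continuousOn
  simp only [Set.mem_Icc, Set.mem_ofPred_eq] at hz hs' hle
  have hbelow : ∀ s', 0 ≤ s' → s' < s → ∀ z', z₀ ≤ z' → 0 < evalEval z' (e * s') Φ := by
    intro s' h0 hlt z' hz'
    by_contra hneg'
    rcases le_total M z' with hMz | hMz
    · exact hneg' (hM z' hMz _ (habs s' h0 (hlt.le.trans hs'.2)))
    · have := isMinOn_iff.mp hmin (z', s')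
        ⟨⟨⟨hz', hMz⟩, ⟨h0, hlt.le.trans hs'.2⟩⟩, not_lt.mp hneg'⟩
      exact absurd hlt (not_lt.mpr this)
  have hder : ∀ s', HasDerivAt (fun s' => evalEval z (e * s') Φ)
      (e * evalEval z (e * s') (derivative Φ)) s' := by
    intro s'
    have h1 := (Φ.map (evalRingHom z)).hasDerivAt (e * s')
    have h2 : HasDerivAt (fun s' : ℝ => e * s') e s' := by
      simpa using (hasDerivAt_id s').const_mul e
    have h3 := h1.comp s' h2
    rw [derivative_map, map_evalRingHom_eval, mul_comm] at h3
    refine h3.congr_of_eventuallyEq (Filter.Eventually.of_forall fun x => ?_)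
    simp [map_evalRingHom_eval]
  have hmono : MonotoneOn (fun s' => evalEval z (e * s') Φ) (Set.Icc 0 s) := by
    apply monotoneOn_of_deriv_nonneg (convex_Icc 0 s)
    · exact fun x _ => (hder x).continuousAt.continuousWithinAt
    · exact fun x _ => (hder x).differentiableAt.differentiableWithinAt
    intro x hx
    rw [interior_Icc] at hx
    rw [(hder x).deriv]
    exact hs.mul_div_nonneg hm (e * x) (hbelow x hx.1.le hx.2) hz.1
  have := hmono ⟨le_rfl, hs'.1⟩ ⟨hs'.1, le_rfl⟩ hs'.1
  simp only [mul_zero] at this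
  linarith [hinit z (hz₀.trans_le hz.1)]

/-- The real slices of a stable polynomial are real-rooted. -/
theorem Stable.splits {e : ℝ} (he : e ≠ 0) {Φ : ℝ[X][X]} (hs : Stable e Φ) {z₀ : ℝ}
    (h0 : Φ.map (evalRingHom z₀) ≠ 0) : (Φ.map (evalRingHom z₀)).Splits := by
  have hcoe : ∀ t : ℂ, aeval t (Φ.map (evalRingHom z₀)) = (slice z₀ Φ).eval t := by
    intro t
    rw [slice_ofReal, eval_map_algebraMap]
  have key : ∀ x₀ : ℂ, 0 < e * x₀.im → aeval x₀ (Φ.map (evalRingHom z₀)) ≠ 0 := by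
    intro x₀ hx₀ hroot
    -- In the manner of Hurwitz: the comparison of the values at x₁ and x₀, with a constant
    -- independent of y, survives the limit z₀ + iy → z₀, so a zero at x₀ makes the whole slice
    -- vanish.
    have hzero : ∀ x₁ : ℂ, (slice z₀ Φ).eval x₁ = 0 := by
      intro x₁
      have htend : Filter.Tendsto (fun y : ℝ => (z₀ : ℂ) + y * Complex.I)
          (nhdsWithin 0 (Set.Ioi 0)) (nhds (z₀ : ℂ)) := by
        have : Continuous fun y : ℝ => (z₀ : ℂ) + y * Complex.I := by fun_prop
        have := this.tendsto 0
        simp only [Complex.ofReal_zero, zero_mul, add_zero] at this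
        exact this.mono_left nhdsWithin_le_nhds
      have hlim : ∀ x, Filter.Tendsto (fun y : ℝ => ‖(slice ((z₀ : ℂ) + y * Complex.I) Φ).eval x‖)
          (nhdsWithin 0 (Set.Ioi 0)) (nhds ‖(slice z₀ Φ).eval x‖) := fun x =>
        (((continuous_eval_slice Φ x).tendsto _).comp htend).norm
      have hle := le_of_tendsto_of_tendsto (hlim x₁)
        ((hlim x₀).const_mul ((1 + ‖x₁ - x₀‖ / |x₀.im|) ^ Φ.natDegree)) (by
          filter_upwards [self_mem_nhdsWithin] with y hy
          have hy : 0 < y := hy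
          exact norm_eval_le_of_halfPlane (hs _ (by simpa using hy)) hx₀ natDegree_map_le)
      rw [← hcoe x₀, hroot, norm_zero, mul_zero] at hle
      simpa using hle
    apply h0
    have : slice (z₀ : ℂ) Φ = 0 := Polynomial.funext fun x => by simpa using hzero x
    rw [slice_ofReal] at this
    exact (Polynomial.map_eq_zero _).mp this
  refine splits_of_forall_aeval_ne_zero fun t ht hroot => ?_
  rcases lt_or_gt_of_ne (mul_ne_zero he ht) with h | h
  · refine key ((starRingEnd ℂ) t) (by simpa using h) ?_
    rw [aeval_conj, hroot, map_zero]
  · exact key t h hroot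

/-- Replacing the differential operator `1 - ∂` by a unit shift does not increase the largest
root. -/
theorem Stable.evalEval_neg_one_ne_zero {e : ℝ} (he : e = 1 ∨ e = -1) {Φ : ℝ[X][X]}
    (hs : Stable e Φ) (hm : InnerMonic Φ) {r : ℝ}
    (h : ∀ z, r < z → evalEval z 0 (Φ - derivative Φ) ≠ 0) {z : ℝ} (hz : r < z) :
    evalEval z (-1) Φ ≠ 0 := by
  -- Positivity of Φ - ∂ₜΦ spreads from t = 0 to the ray t = es, as the univariate lemmas require.
  have hpos : ∀ s, 0 ≤ s → 0 < (Φ.map (evalRingHom z) -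
      derivative (Φ.map (evalRingHom z))).eval (e * s) := by
    intro s hs0
    have := hs.sub_derivative.evalEval_pos hm.sub_derivative h hz hs0
    rwa [← map_evalRingHom_eval, Polynomial.map_sub, ← derivative_map] at this
  have h0 : Φ.map (evalRingHom z) ≠ 0 := by
    intro h0
    have := hpos 0 le_rfl
    simp [h0] at this
  rw [← map_evalRingHom_eval]
  rcases he with rfl | rfl
  · exact eval_neg_one_ne_zero_of_pos_right (hs.splits one_ne_zero h0)
      fun t ht => by simpa using hpos t ht
  · exact eval_neg_one_ne_zero_of_pos_left (hs.splits (by norm_num) h0)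
      fun t ht => by simpa using hpos (-t) (by linarith)

end Bivariate

/-! ### Several variables: reduction to two by real specialization -/

namespace StablePolynomial

open MvPolynomial

section Slice

variable {σ R S : Type*} [DecidableEq σ] [CommRing R] [CommRing S]

/-- The univariate polynomial obtained by specializing all variables but one. -/
noncomputable def sliceHom (φ : R →+* S) (i : σ) (y : σ → S) : MvPolynomial σ R →+* S[X] :=
  eval₂Hom (Polynomial.C.comp φ) fun j => if j = i then Polynomial.X else Polynomial.C (y j)

theorem eval_sliceHom (φ : R →+* S) (i : σ) (y : σ → S) (t : S) (P : MvPolynomial σ R) :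
    (sliceHom φ i y P).eval t = eval₂ φ (Function.update y i t) P := by
  have : (Polynomial.evalRingHom t).comp (sliceHom φ i y) =
      eval₂Hom φ (Function.update y i t) := by
    apply MvPolynomial.ringHom_ext
    · intro r
      simp [sliceHom]
    · intro j
      by_cases h : j = i
      · subst h
        simp [sliceHom]
      · simp [sliceHom, h]
  exact congrArg (fun f => f P) this

theorem derivative_sliceHom (φ : R →+* S) (i : σ) (y : σ → S) (P : MvPolynomial σ R) :
    Polynomial.derivative (sliceHom φ i y P) = sliceHom φ i y (pderiv i P) := by
  induction P using MvPolynomial.induction_on with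
  | C a => simp [sliceHom]
  | add p q hp hq => simp [hp, hq]
  | mul_X p j hp =>
    rw [map_mul, Polynomial.derivative_mul, hp, pderiv_mul, map_add, map_mul, map_mul, pderiv_X]
    by_cases h : j = i
    · subst h
      simp [sliceHom]
    · simp [sliceHom, h]

end Slice

variable {σ : Type*}

/-- A polynomial without zeros where the inner variable is in the open upper half plane and the
others are in the closed half planes given by the signs of `ε`. -/
def Stable (ε : σ → ℝ) (P : MvPolynomial σ ℝ[X]) : Prop :=
  ∀ z : ℂ, 0 < z.im → ∀ x : σ → ℂ, (∀ i, 0 ≤ ε i * (x i).im) →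
    eval₂ (Polynomial.aeval z : ℝ[X] →ₐ[ℝ] ℂ).toRingHom x P ≠ 0

/-- Monic in the inner variable, uniformly in the others. -/
def InnerMonic (P : MvPolynomial σ ℝ[X]) : Prop :=
  (coeff 0 P).Monic ∧ ∀ α, α ≠ 0 → (coeff α P).degree < (coeff 0 P).degree

theorem Stable.sub_pderiv [DecidableEq σ] {ε : σ → ℝ} {P : MvPolynomial σ ℝ[X]} (h : Stable ε P) (i : σ) :
    Stable ε (P - pderiv i P) := by
  intro z hz x hx
  have h1 : ∀ Q : MvPolynomial σ ℝ[X],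
      eval₂ (Polynomial.aeval z : ℝ[X] →ₐ[ℝ] ℂ).toRingHom x Q =
        (sliceHom (Polynomial.aeval z : ℝ[X] →ₐ[ℝ] ℂ).toRingHom i x Q).eval (x i) := by
    intro Q
    rw [eval_sliceHom, Function.update_eq_self]
  rw [h1, map_sub, ← derivative_sliceHom]
  refine eval_sub_derivative_ne_zero (e := ε i) (fun t ht => ?_) (hx i)
  rw [eval_sliceHom]
  refine h z hz _ fun j => ?_
  by_cases hj : j = i
  · subst hj
    simpa using ht
  · simpa [hj] using hx j

theorem degree_coeff_pderiv_lt {P : MvPolynomial σ ℝ[X]} (h : InnerMonic P) (i : σ)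
    (α : σ →₀ ℕ) : (coeff α (pderiv i P)).degree < (coeff 0 P).degree := by
  rw [coeff_pderiv]
  refine lt_of_le_of_lt ?_ (h.2 (α + Finsupp.single i 1) ?_)
  · have : ((α i : ℝ[X]) + 1) = Polynomial.C ((α i : ℝ) + 1) := by simp
    rw [this, mul_comm]
    exact degree_C_mul_le_degree _ _
  · intro h0
    have := DFunLike.congr_fun h0 i
    simp at this

theorem InnerMonic.sub_pderiv {P : MvPolynomial σ ℝ[X]} (h : InnerMonic P) (i : σ) :
    InnerMonic (P - pderiv i P) := by
  have h0 : coeff 0 (P - pderiv i P) = coeff 0 P - coeff 0 (pderiv i P) := coeff_sub _ _ _ _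
  have hd := Polynomial.degree_sub_eq_left_of_degree_lt (degree_coeff_pderiv_lt h i 0)
  refine ⟨?_, fun α hα => ?_⟩
  · rw [h0]
    exact h.1.sub_of_left (degree_coeff_pderiv_lt h i 0)
  · rw [h0, hd, coeff_sub]
    exact (Polynomial.degree_sub_le _ _).trans_lt
      (max_lt (h.2 α hα) (degree_coeff_pderiv_lt h i α))

/-- The bivariate polynomial obtained by specializing all variables but one to real numbers. -/
noncomputable def toBivariate [DecidableEq σ] (i : σ) (x : σ → ℝ) : MvPolynomial σ ℝ[X] →+* ℝ[X][X] :=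
  sliceHom (RingHom.id ℝ[X]) i fun j => Polynomial.C (x j)

theorem slice_toBivariate [DecidableEq σ] (z : ℂ) (i : σ) (x : σ → ℝ) (P : MvPolynomial σ ℝ[X]) :
    Bivariate.slice z (toBivariate i x P) =
      sliceHom (Polynomial.aeval z : ℝ[X] →ₐ[ℝ] ℂ).toRingHom i (fun j => (x j : ℂ)) P := by
  have : (Bivariate.slice z).comp (toBivariate i x) =
      sliceHom (Polynomial.aeval z : ℝ[X] →ₐ[ℝ] ℂ).toRingHom i (fun j => (x j : ℂ)) := by
    apply MvPolynomial.ringHom_ext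
    · intro r
      simp [sliceHom, toBivariate, Bivariate.slice]
    · intro j
      by_cases h : j = i
      · simp [sliceHom, toBivariate, Bivariate.slice, h]
      · simp [sliceHom, toBivariate, Bivariate.slice, h]
  exact congrArg (fun f => f P) this

theorem evalEval_toBivariate [DecidableEq σ] (z t : ℝ) (i : σ) (x : σ → ℝ) (P : MvPolynomial σ ℝ[X]) :
    Polynomial.evalEval z t (toBivariate i x P) =
      eval₂ (Polynomial.evalRingHom z) (Function.update x i t) P := by
  have : (Polynomial.evalEvalRingHom z t).comp (toBivariate i x) =
      eval₂Hom (Polynomial.evalRingHom z) (Function.update x i t) := by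
    apply MvPolynomial.ringHom_ext
    · intro r
      simp [sliceHom, toBivariate]
    · intro j
      by_cases h : j = i
      · subst h
        simp [sliceHom, toBivariate]
      · simp [sliceHom, toBivariate, h]
  exact congrArg (fun f => f P) this

theorem Stable.toBivariate [DecidableEq σ] {ε : σ → ℝ} {P : MvPolynomial σ ℝ[X]} (h : Stable ε P) (i : σ)
    (x : σ → ℝ) : Bivariate.Stable (ε i) (toBivariate i x P) := by
  intro z hz t ht
  rw [slice_toBivariate, eval_sliceHom]
  refine h z hz _ fun j => ?_
  by_cases hj : j = i
  · subst hj
    simpa using ht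
  · simp [hj]

theorem InnerMonic.toBivariate [DecidableEq σ] {P : MvPolynomial σ ℝ[X]} (h : InnerMonic P) (i : σ)
    (x : σ → ℝ) : Bivariate.InnerMonic (toBivariate i x P) := by
  classical
  -- The monomial of exponent α after specialization. Its coefficients are real scalars, so they
  -- raise no degree in z, and `u 0 = 1` sends the dominant coefficient to the constant term only.
  let u : (σ →₀ ℕ) → ℝ[X] := fun α =>
    ∏ j ∈ α.support, (if j = i then Polynomial.X else Polynomial.C (x j)) ^ α j
  have hsum : ∀ k, (StablePolynomial.toBivariate i x P).coeff k =
      ∑ α ∈ P.support, Polynomial.C ((u α).coeff k) * coeff α P := by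
    intro k
    rw [StablePolynomial.toBivariate, sliceHom, coe_eval₂Hom, eval₂_eq, Polynomial.finsetSum_coeff]
    refine Finset.sum_congr rfl fun α _ => ?_
    have : ∏ j ∈ α.support, (if j = i then Polynomial.X else
        Polynomial.C (Polynomial.C (x j)) : ℝ[X][X]) ^ α j = (u α).map Polynomial.C := by
      rw [Polynomial.map_prod]
      refine Finset.prod_congr rfl fun j _ => ?_
      rw [Polynomial.map_pow]
      split_ifs <;> simp
    rw [this, RingHom.comp_apply, Polynomial.coeff_C_mul, Polynomial.coeff_map, mul_comm]
    rfl
  have hne : coeff 0 P ≠ 0 := h.1.ne_zero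
  have hmem : (0 : σ →₀ ℕ) ∈ P.support := mem_support_iff.mpr hne
  have hu0 : u 0 = 1 := by simp [u]
  have hlt : ∀ k, (∑ α ∈ P.support \ {0}, Polynomial.C ((u α).coeff k) * coeff α P).degree <
      (coeff 0 P).degree := by
    intro k
    refine (Polynomial.degree_sum_le _ _).trans_lt ?_
    rw [Finset.sup_lt_iff (bot_lt_iff_ne_bot.mpr (by simpa using hne))]
    intro α hα
    refine (degree_C_mul_le_degree _ _).trans_lt (h.2 α ?_)
    simpa using (Finset.mem_sdiff.mp hα).2
  have hsplit : ∀ k, (StablePolynomial.toBivariate i x P).coeff k =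
      (∑ α ∈ P.support \ {0}, Polynomial.C ((u α).coeff k) * coeff α P) +
        Polynomial.C ((1 : ℝ[X]).coeff k) * coeff 0 P := by
    intro k
    rw [hsum, ← hu0, ← Finset.sum_sdiff (Finset.singleton_subset_iff.mpr hmem),
      Finset.sum_singleton]
  have h0 : (StablePolynomial.toBivariate i x P).coeff 0 =
      (∑ α ∈ P.support \ {0}, Polynomial.C ((u α).coeff 0) * coeff α P) + coeff 0 P := by
    rw [hsplit]
    simp
  rw [Bivariate.InnerMonic, h0, Polynomial.degree_add_eq_right_of_degree_lt (hlt 0)]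
  refine ⟨h.1.add_of_right (hlt 0), fun k hk => ?_⟩
  rw [hsplit, Polynomial.coeff_one, if_neg hk, map_zero, zero_mul, add_zero]
  exact hlt k

/-- The composition of the operators `1 - ∂_i` along a list of variables. -/
noncomputable def oneSubPderivList {R : Type*} [CommRing R] (l : List σ) :
    Module.End R (MvPolynomial σ R) :=
  (l.map fun i => (1 : Module.End R (MvPolynomial σ R)) - (pderiv i).toLinearMap).prod

theorem oneSubPderivList_cons {R : Type*} [CommRing R] (i : σ) (l : List σ)
    (P : MvPolynomial σ R) : oneSubPderivList (i :: l) P =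
      oneSubPderivList l P - pderiv i (oneSubPderivList l P) := by
  simp [oneSubPderivList]

theorem Stable.oneSubPderivList [DecidableEq σ] {ε : σ → ℝ} {P : MvPolynomial σ ℝ[X]} (h : Stable ε P)
    (l : List σ) : Stable ε (oneSubPderivList l P) := by
  induction l with
  | nil => simpa [StablePolynomial.oneSubPderivList] using h
  | cons i l ih =>
    rw [oneSubPderivList_cons]
    exact ih.sub_pderiv i

theorem InnerMonic.oneSubPderivList {P : MvPolynomial σ ℝ[X]} (h : InnerMonic P)
    (l : List σ) : InnerMonic (oneSubPderivList l P) := by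
  induction l with
  | nil => simpa [StablePolynomial.oneSubPderivList] using h
  | cons i l ih =>
    rw [oneSubPderivList_cons]
    exact ih.sub_pderiv i

theorem degree_coeff_zero_oneSubPderivList {P : MvPolynomial σ ℝ[X]} (h : InnerMonic P) (l : List σ) :
    (coeff 0 (oneSubPderivList l P)).degree = (coeff 0 P).degree := by
  induction l with
  | nil => simp [oneSubPderivList]
  | cons i l ih =>
    rw [oneSubPderivList_cons, coeff_sub, Polynomial.degree_sub_eq_left_of_degree_lt
      (degree_coeff_pderiv_lt (h.oneSubPderivList l) i 0), ih]

/-- The largest root of a specialization at `-1` is bounded by that of the corresponding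
specialization at `0` of the polynomial to which the operators `1 - ∂_i` are applied. -/
theorem Stable.eval_neg_one_ne_zero [DecidableEq σ] {ε : σ → ℝ} (hε : ∀ i, ε i = 1 ∨ ε i = -1)
    {P : MvPolynomial σ ℝ[X]} (hs : Stable ε P) (hm : InnerMonic P) {r : ℝ} {l : List σ}
    (hl : l.Nodup)
    (h : ∀ z, r < z → eval₂ (Polynomial.evalRingHom z) (fun i => if i ∈ l then 0 else -1)
      (StablePolynomial.oneSubPderivList l P) ≠ 0) {z : ℝ} (hz : r < z) :
    eval₂ (Polynomial.evalRingHom z) (fun _ => -1) P ≠ 0 := by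
  induction l with
  | nil => simpa [StablePolynomial.oneSubPderivList] using h z hz
  | cons i l ih =>
    obtain ⟨hi, hl⟩ := List.nodup_cons.mp hl
    -- The variables in the list carry an operator and sit at 0, the others sit at -1. The bivariate
    -- exchange moves the head i from the first kind to the second, and `hi` ensures that it sits at
    -- -1 afterwards.
    refine ih hl fun z hz => ?_
    have key := ((hs.oneSubPderivList l).toBivariate i
      (fun j => if j ∈ l then 0 else -1)).evalEval_neg_one_ne_zero (hε i)
      ((hm.oneSubPderivList l).toBivariate i _) (r := r) ?_ hz
    · rw [evalEval_toBivariate] at key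
      convert key using 2
      funext j
      by_cases hj : j = i
      · subst hj
        simp [hi]
      · simp [hj]
    · intro w hw
      have := h w hw
      rw [oneSubPderivList_cons] at this
      rw [StablePolynomial.toBivariate, derivative_sliceHom, ← map_sub,
        ← StablePolynomial.toBivariate, evalEval_toBivariate]
      convert this using 2
      funext j
      by_cases hj : j = i
      · subst hj
        simp
      · simp [hj]

end StablePolynomial

/-! ### The determinantal polynomial is real, monic and stable -/

namespace StablePolynomial

open MvPolynomial

/-- Reading a univariate polynomial over a multivariate polynomial ring the other way round. -/
noncomputable def swapHom (σ : Type*) :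
    (MvPolynomial σ ℂ)[X] →+* MvPolynomial σ ℂ[X] :=
  Polynomial.eval₂RingHom (MvPolynomial.map Polynomial.C) (MvPolynomial.C Polynomial.X)

theorem coeff_coeff_swapHom {σ : Type*} (q : (MvPolynomial σ ℂ)[X]) (α : σ →₀ ℕ) (k : ℕ) :
    (coeff α (swapHom σ q)).coeff k = coeff α (q.coeff k) := by
  induction q using Polynomial.induction_on' with
  | add p q hp hq => simp [hp, hq]
  | monomial n a =>
    rw [swapHom, Polynomial.coe_eval₂RingHom, Polynomial.eval₂_monomial, ← map_pow, mul_comm,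
      coeff_C_mul, mul_comm, coeff_map, Polynomial.coeff_C_mul, Polynomial.coeff_X_pow, Polynomial.coeff_monomial]
    by_cases h : k = n
    · subst h
      simp
    · simp [h, Ne.symm h]

theorem determinantalPoly_eq_swapHom {m d : ℕ} (B : Fin m → Matrix (Fin d) (Fin d) ℂ) :
    determinantalPoly B = swapHom (Fin m)
      (-∑ i, (X i : MvPolynomial (Fin m) ℂ) • (B i).map C).charpoly := by
  rw [Matrix.charpoly, RingHom.map_det, determinantalPoly]
  congr 1
  ext1 a b
  simp only [RingHom.mapMatrix_apply, Matrix.map_apply, Matrix.charmatrix_apply, Matrix.add_apply,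
    Matrix.smul_apply, Matrix.one_apply, Matrix.neg_apply, Matrix.sum_apply, smul_eq_mul,
    Matrix.diagonal_apply, map_neg, sub_neg_eq_add]
  rw [map_add (swapHom (Fin m))]
  congr 1
  · split_ifs <;> simp [swapHom]
  · rw [map_sum Polynomial.C, map_sum (swapHom (Fin m))]
    simp [swapHom]

/-- Read in z, this is a characteristic polynomial over the ring of x-polynomials. Its leading
coefficient 1 involves no x, so every other x-monomial occurs only with lower powers of z. -/
theorem monic_coeff_zero_determinantalPoly {m d : ℕ} (B : Fin m → Matrix (Fin d) (Fin d) ℂ) :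
    (coeff 0 (determinantalPoly B)).Monic ∧ (coeff 0 (determinantalPoly B)).degree = d ∧
      ∀ α, α ≠ 0 → (coeff α (determinantalPoly B)).degree < d := by
  rw [determinantalPoly_eq_swapHom]
  set q := (-∑ i, (X i : MvPolynomial (Fin m) ℂ) •
    (B i).map (C : ℂ → MvPolynomial (Fin m) ℂ)).charpoly with hq
  have hmon : q.Monic := Matrix.charpoly_monic _
  have hdeg : q.natDegree = d := by
    rw [hq, Matrix.charpoly_natDegree_eq_dim, Fintype.card_fin]
  have hd1 : q.coeff d = 1 := by rw [← hdeg]; exact hmon.coeff_natDegree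
  have hle : (coeff 0 (swapHom (Fin m) q)).natDegree ≤ d := by
    rw [Polynomial.natDegree_le_iff_coeff_eq_zero]
    intro k hk
    rw [coeff_coeff_swapHom, Polynomial.coeff_eq_zero_of_natDegree_lt (by omega), coeff_zero]
  have hone : (coeff 0 (swapHom (Fin m) q)).coeff d = 1 := by
    rw [coeff_coeff_swapHom, hd1, coeff_zero_one]
  refine ⟨Polynomial.monic_of_natDegree_le_of_coeff_eq_one d hle hone, ?_, fun α hα => ?_⟩
  · exact Polynomial.degree_eq_of_le_of_coeff_ne_zero
      (Polynomial.natDegree_le_iff_degree_le.mp hle) (by rw [hone]; exact one_ne_zero)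
  · rw [Polynomial.degree_lt_iff_coeff_zero]
    intro k hk
    rw [coeff_coeff_swapHom]
    rcases hk.eq_or_lt with h | h
    · rw [← h, hd1, coeff_one, if_neg (Ne.symm hα)]
    · rw [Polynomial.coeff_eq_zero_of_natDegree_lt (by omega), coeff_zero]

theorem eval₂_determinantalPoly {m d : ℕ} (B : Fin m → Matrix (Fin d) (Fin d) ℂ) (z : ℂ)
    (x : Fin m → ℂ) : eval₂ (Polynomial.evalRingHom z) x (determinantalPoly B) =
      (z • (1 : Matrix (Fin d) (Fin d) ℂ) + ∑ i, x i • B i).det := by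
  rw [← coe_eval₂Hom, determinantalPoly, RingHom.map_det]
  congr 1
  ext1 a b
  simp only [RingHom.mapMatrix_apply, Matrix.map_apply, Matrix.add_apply,
    Matrix.smul_apply, Matrix.one_apply, Matrix.sum_apply, smul_eq_mul, map_add, map_sum, map_mul]
  congr 1
  · split_ifs <;> simp
  · simp

/-- Conjugating the entries of a Hermitian matrix transposes it, and the determinant ignores
transposition. -/
theorem map_conj_determinantalPoly {m d : ℕ} (B : Fin m → Matrix (Fin d) (Fin d) ℂ)
    (hB : ∀ i, (B i).IsHermitian) :
    MvPolynomial.map (Polynomial.mapRingHom (starRingEnd ℂ)) (determinantalPoly B) =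
      determinantalPoly B := by
  rw [determinantalPoly, RingHom.map_det, ← Matrix.det_transpose]
  congr 1
  ext1 a b
  have h : ∀ i, star (B i b a) = B i a b := fun i => (hB i).apply a b
  simp only [RingHom.mapMatrix_apply, Matrix.map_apply, Matrix.add_apply, Matrix.transpose_apply,
    Matrix.smul_apply, Matrix.one_apply, Matrix.sum_apply, smul_eq_mul, map_add, map_sum, map_mul]
  congr 1
  · by_cases hab : a = b
    · simp [hab]
    · simp [hab, Ne.symm hab]
  · refine Finset.sum_congr rfl fun i _ => ?_
    simp [← h i]

theorem exists_map_eq_determinantalPoly {m d : ℕ} (B : Fin m → Matrix (Fin d) (Fin d) ℂ)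
    (hB : ∀ i, (B i).IsHermitian) : ∃ P : MvPolynomial (Fin m) ℝ[X],
      MvPolynomial.map (Polynomial.mapRingHom (algebraMap ℝ ℂ)) P = determinantalPoly B := by
  rw [← Set.mem_range, mem_range_map_iff_coeffs_subset]
  intro c hc
  obtain ⟨α, -, rfl⟩ := mem_coeffs_iff.mp hc
  have h := congrArg (coeff α) (map_conj_determinantalPoly B hB)
  rw [coeff_map] at h
  refine (Polynomial.mem_lifts _).mp ((Polynomial.lifts_iff_coeff_lifts _).mpr fun n => ?_)
  have hn := congrArg (fun p => p.coeff n) h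
  simp only [Polynomial.coe_mapRingHom, Polynomial.coeff_map] at hn
  exact ⟨_, (Complex.conj_eq_iff_re.mp hn)⟩

theorem innerMonic_of_map_eq {m d : ℕ} {B : Fin m → Matrix (Fin d) (Fin d) ℂ}
    {P : MvPolynomial (Fin m) ℝ[X]}
    (hP : MvPolynomial.map (Polynomial.mapRingHom (algebraMap ℝ ℂ)) P = determinantalPoly B) :
    InnerMonic P ∧ (coeff 0 P).degree = d := by
  obtain ⟨h1, h2, h3⟩ := monic_coeff_zero_determinantalPoly B
  have hc : ∀ α, coeff α (determinantalPoly B) = (coeff α P).map (algebraMap ℝ ℂ) := by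
    intro α
    rw [← hP, coeff_map, Polynomial.coe_mapRingHom]
  simp only [hc, Polynomial.degree_map, Polynomial.monic_map_iff] at h1 h2 h3
  exact ⟨⟨h1, fun α hα => h2.symm ▸ h3 α hα⟩, h2⟩

theorem eval₂_aeval_of_map_eq {m d : ℕ} {B : Fin m → Matrix (Fin d) (Fin d) ℂ}
    {P : MvPolynomial (Fin m) ℝ[X]}
    (hP : MvPolynomial.map (Polynomial.mapRingHom (algebraMap ℝ ℂ)) P = determinantalPoly B)
    (z : ℂ) (x : Fin m → ℂ) :
    eval₂ (Polynomial.aeval z : ℝ[X] →ₐ[ℝ] ℂ).toRingHom x P =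
      (z • (1 : Matrix (Fin d) (Fin d) ℂ) + ∑ i, x i • B i).det := by
  rw [← eval₂_determinantalPoly, ← hP, eval₂_map]
  congr 1
  ext <;> simp

theorem ofReal_eval₂_of_map_eq {m d : ℕ} {B : Fin m → Matrix (Fin d) (Fin d) ℂ}
    {P : MvPolynomial (Fin m) ℝ[X]}
    (hP : MvPolynomial.map (Polynomial.mapRingHom (algebraMap ℝ ℂ)) P = determinantalPoly B)
    (z : ℝ) (x : Fin m → ℝ) :
    ((eval₂ (Polynomial.evalRingHom z) x P : ℝ) : ℂ) =
      ((z : ℂ) • (1 : Matrix (Fin d) (Fin d) ℂ) + ∑ i, (x i : ℂ) • B i).det := by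
  rw [← eval₂_aeval_of_map_eq hP, ← Complex.ofRealHom_eq_coe, ← coe_eval₂Hom, ← RingHom.comp_apply,
    ← coe_eval₂Hom]
  have : Complex.ofRealHom.comp (eval₂Hom (Polynomial.evalRingHom z) x) =
      eval₂Hom (Polynomial.aeval (z : ℂ) : ℝ[X] →ₐ[ℝ] ℂ).toRingHom fun i => (x i : ℂ) := by
    refine MvPolynomial.ringHom_ext (fun r => ?_) fun i => by simp
    simpa using (Polynomial.aeval_algebraMap_apply ℂ z r).symm
  exact congrArg (fun f => f P) this

/-- For a kernel vector v, the imaginary part of the quadratic form at v is Im z ‖v‖² + Σ εᵢ Im xᵢ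
⟨v, Aᵢv⟩, where the first term is positive and the others are nonnegative. -/
theorem stable_of_map_eq {m d : ℕ} {A : Fin m → Matrix (Fin d) (Fin d) ℂ}
    (hA : ∀ i, (A i).PosSemidef) {ε : Fin m → ℝ} {P : MvPolynomial (Fin m) ℝ[X]}
    (hP : MvPolynomial.map (Polynomial.mapRingHom (algebraMap ℝ ℂ)) P =
      determinantalPoly fun i => ε i • A i) : Stable ε P := by
  intro z hz x hx
  rw [eval₂_aeval_of_map_eq hP]
  intro hdet
  obtain ⟨v, hv, hMv⟩ := Matrix.exists_mulVec_eq_zero_iff.mpr hdet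
  have h := congrArg (fun w => (star v ⬝ᵥ w).im) hMv
  simp only [Matrix.add_mulVec, Matrix.smul_mulVec, Matrix.one_mulVec, Matrix.sum_mulVec,
    dotProduct_add, dotProduct_smul, dotProduct_sum, dotProduct_zero, Complex.add_im,
    Complex.im_sum, smul_eq_mul, Complex.zero_im] at h
  have hvpos : 0 < star v ⬝ᵥ v := Matrix.dotProduct_star_self_pos_iff.mpr hv
  obtain ⟨h1, h2⟩ := Complex.pos_iff.mp hvpos
  have hfirst : 0 < (z * (star v ⬝ᵥ v)).im := by
    rw [Complex.mul_im, ← h2, mul_zero, zero_add]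
    exact mul_pos hz h1
  have hsum : 0 ≤ ∑ i, (x i * ε i • (star v ⬝ᵥ (A i).mulVec v)).im := by
    refine Finset.sum_nonneg fun i _ => ?_
    obtain ⟨h3, h4⟩ := Complex.nonneg_iff.mp ((hA i).dotProduct_mulVec_nonneg v)
    rw [Complex.mul_im, Complex.smul_im, Complex.smul_re, ← h4, smul_zero, mul_zero, zero_add,
      smul_eq_mul, ← mul_assoc, mul_comm (x i).im]
    exact mul_nonneg (hx i) h3
  linarith

theorem mixedCharPoly_eq_map {m d : ℕ} {B : Fin m → Matrix (Fin d) (Fin d) ℂ}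
    {P : MvPolynomial (Fin m) ℝ[X]}
    (hP : MvPolynomial.map (Polynomial.mapRingHom (algebraMap ℝ ℂ)) P = determinantalPoly B) :
    mixedCharPoly B =
      (coeff 0 (oneSubPderivList (List.finRange m) P)).map (algebraMap ℝ ℂ) := by
  have hcomm : ∀ l : List (Fin m), oneSubPderivList l (determinantalPoly B) =
      MvPolynomial.map (Polynomial.mapRingHom (algebraMap ℝ ℂ)) (oneSubPderivList l P) := by
    intro l
    induction l with
    | nil => simp [oneSubPderivList, hP]
    | cons i l ih =>
      rw [oneSubPderivList_cons, oneSubPderivList_cons, ih, pderiv_map, map_sub]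
  rw [mixedCharPoly, oneSubPderivProd, List.ofFn_eq_map, ← oneSubPderivList, hcomm]
  change MvPolynomial.eval 0 _ = _
  rw [MvPolynomial.eval_zero, constantCoeff_eq, coeff_map, Polynomial.coe_mapRingHom]

end StablePolynomial

/-! ### Mixed characteristic polynomials and the norm bound -/

open StablePolynomial

theorem mixedCharPoly_properties {m d : ℕ} {A : Fin m → Matrix (Fin d) (Fin d) ℂ}
    (hA : ∀ i, (A i).PosSemidef) {ε : Fin m → ℝ} (hε : ∀ i, ε i = 1 ∨ ε i = -1) :
    (mixedCharPoly fun i => ε i • A i).Monic ∧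
    (mixedCharPoly fun i => ε i • A i).degree = d ∧
    (∀ z : ℂ, (mixedCharPoly fun i => ε i • A i).IsRoot z → z.im = 0) ∧
    ∀ r : ℝ, (∀ z : ℝ, r < z → ¬ (mixedCharPoly fun i => ε i • A i).IsRoot z) →
      ∀ z : ℝ, r < z →
        ((z : ℂ) • (1 : Matrix (Fin d) (Fin d) ℂ) - ∑ i, ε i • A i).det ≠ 0 := by
  have hB : ∀ i, (ε i • A i).IsHermitian := fun i => by
    rw [Matrix.IsHermitian, Matrix.conjTranspose_smul, (hA i).isHermitian.eq, star_trivial]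
  obtain ⟨P, hP⟩ := exists_map_eq_determinantalPoly _ hB
  obtain ⟨hm, hd⟩ := innerMonic_of_map_eq hP
  have hs := stable_of_map_eq hA hP
  rw [mixedCharPoly_eq_map hP]
  set l := List.finRange m
  refine ⟨(hm.oneSubPderivList l).1.map _, ?_, ?_, ?_⟩
  · rw [Polynomial.degree_map, degree_coeff_zero_oneSubPderivList hm, hd]
  · intro z hz
    rw [Polynomial.IsRoot, Polynomial.eval_map_algebraMap] at hz
    have key : ∀ w : ℂ, 0 < w.im → Polynomial.aeval w
        (MvPolynomial.coeff 0 (oneSubPderivList l P)) ≠ 0 := by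
      intro w hw
      -- The point x = 0 is real, hence in every closed half plane. The lower half plane is then
      -- excluded by conjugation.
      have := hs.oneSubPderivList l w hw (fun _ => 0) (by simp)
      rwa [MvPolynomial.eval₂_zero'_apply, MvPolynomial.constantCoeff_eq] at this
    by_contra h
    rcases lt_or_gt_of_ne h with h | h
    · refine key ((starRingEnd ℂ) z) (by simpa using h) ?_
      rw [Polynomial.aeval_conj, hz, map_zero]
    · exact key z h hz
  · intro r hr z hz
    have key := hs.eval_neg_one_ne_zero hε hm (l := l) (List.nodup_finRange m) (r := r) ?_ hz
    · have h := ofReal_eval₂_of_map_eq hP z fun _ => -1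
      intro h0
      apply key
      rw [← Complex.ofReal_eq_zero, h, ← h0]
      congr 1
      simp [sub_eq_add_neg]
    · intro w hw
      have h1 : (fun i => if i ∈ l then (0 : ℝ) else -1) = fun _ => 0 := by
        funext i
        simp [l]
      rw [h1, MvPolynomial.eval₂_zero'_apply, MvPolynomial.constantCoeff_eq]
      intro h0
      refine hr w hw ?_
      rw [Polynomial.IsRoot, Polynomial.eval_map_algebraMap]
      have := Polynomial.aeval_algebraMap_apply ℂ w
        (MvPolynomial.coeff 0 (oneSubPderivList l P))
      rw [Polynomial.coe_aeval_eq_eval, show Polynomial.eval w _ = 0 from h0, map_zero] at this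
      exact this

/-- The norm of a self-adjoint operator is its spectral radius, and its complex spectrum is real. -/
theorem Matrix.norm_toEuclideanCLM_le_of_spectrum {d : ℕ} {S : Matrix (Fin d) (Fin d) ℂ}
    (hS : S.IsHermitian) {r : ℝ} (hr : 0 ≤ r) (h : ∀ t ∈ spectrum ℝ S, -r ≤ t ∧ t ≤ r) :
    ‖Matrix.toEuclideanCLM (n := Fin d) (𝕜 := ℂ) S‖ ≤ r := by
  have hsa : IsSelfAdjoint (Matrix.toEuclideanCLM (n := Fin d) (𝕜 := ℂ) S) := by
    rw [IsSelfAdjoint, ← map_star]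
    exact congrArg _ hS
  have hrad := hsa.spectralRadius_eq_nnnorm
  have hle : spectralRadius ℂ (Matrix.toEuclideanCLM (n := Fin d) (𝕜 := ℂ) S) ≤
      (Real.toNNReal r : ENNReal) := by
    refine iSup₂_le fun z hz => ?_
    have hre := hsa.mem_spectrum_eq_re hz
    rw [AlgEquiv.spectrum_eq] at hz
    have hz' : z.re ∈ spectrum ℝ S := by
      rw [hre] at hz
      exact (spectrum.algebraMap_mem_iff ℂ).mp hz
    rw [ENNReal.coe_le_coe, ← NNReal.coe_le_coe, coe_nnnorm, Real.coe_toNNReal r hr, hre, Complex.norm_real,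
      Real.norm_eq_abs]
    exact abs_le.mpr (h _ hz')
  rw [hrad, ENNReal.coe_le_coe, ← NNReal.coe_le_coe, Real.coe_toNNReal r hr] at hle
  exact hle

theorem Matrix.det_eq_zero_of_mem_spectrum {d : ℕ} {S : Matrix (Fin d) (Fin d) ℂ} {t : ℝ}
    (ht : t ∈ spectrum ℝ S) : ((t : ℂ) • (1 : Matrix (Fin d) (Fin d) ℂ) - S).det = 0 := by
  rw [spectrum.mem_iff, Matrix.isUnit_iff_isUnit_det, isUnit_iff_ne_zero, not_not] at ht
  rw [← ht, Algebra.algebraMap_eq_smul_one]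
  simp

theorem lemma2p13 {m d : ℕ} (hd : 1 ≤ d) (A : Fin m → Matrix (Fin d) (Fin d) ℂ)
    (hA : ∀ i, (A i).PosSemidef) (ε : Fin m → ℝ) (hε : ∀ i, ε i = 1 ∨ ε i = -1) :
    ∃ r : ℝ,
      IsMaxRoot
        (mixedCharPoly (fun i => ε i • A i) * mixedCharPoly (fun i => (-ε i) • A i)) r ∧
      ‖Matrix.toEuclideanCLM (n := Fin d) (𝕜 := ℂ) (∑ i, ε i • A i)‖ ≤ r ∧
      ∀ t ∈ spectrum ℝ (∑ i, ε i • A i), -r ≤ t ∧ t ≤ r := by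
  obtain ⟨hm₁, hd₁, hr₁, hb₁⟩ := mixedCharPoly_properties hA hε
  obtain ⟨hm₂, -, hr₂, hb₂⟩ := mixedCharPoly_properties hA (ε := fun i => -ε i) fun i => by
    rcases hε i with h | h <;> simp [h]
  set p₁ := mixedCharPoly fun i => ε i • A i
  set p₂ := mixedCharPoly fun i => (-ε i) • A i
  have hne : p₁ * p₂ ≠ 0 := (hm₁.mul hm₂).ne_zero
  have hreal : ∀ z, (p₁ * p₂).IsRoot z → z.im = 0 := by
    intro z hz
    rcases Polynomial.root_mul.mp hz with h | h
    exacts [hr₁ z h, hr₂ z h]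
  obtain ⟨z₀, hz₀⟩ := IsAlgClosed.exists_root p₁ (by
    rw [hd₁]
    exact_mod_cast (by omega : d ≠ 0))
  obtain ⟨w, hw, hmax⟩ := (p₁ * p₂).roots.toFinset.exists_max_image Complex.re
    ⟨z₀, by simpa using ⟨⟨hm₁.ne_zero, hm₂.ne_zero⟩, Or.inl hz₀⟩⟩
  have hroot : ∀ z, (p₁ * p₂).IsRoot z ↔ z ∈ (p₁ * p₂).roots.toFinset := by
    intro z
    rw [Multiset.mem_toFinset, Polynomial.mem_roots hne]
  have hw' : (w.re : ℂ) = w :=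
    Complex.ext rfl (by simpa using (hreal w ((hroot w).mpr hw)).symm)
  have hgt : ∀ z : ℝ, w.re < z → ¬ (p₁ * p₂).IsRoot z := by
    intro z hz h
    have := hmax z ((hroot _).mp h)
    rw [Complex.ofReal_re] at this
    linarith
  have hspec : ∀ t ∈ spectrum ℝ (∑ i, ε i • A i), -w.re ≤ t ∧ t ≤ w.re := by
    intro t ht
    have hdet := Matrix.det_eq_zero_of_mem_spectrum ht
    constructor
    -- Here -t is an eigenvalue of the sum with opposite signs, which is governed by `p₂`.
    · by_contra hlt
      refine hb₂ w.re (fun z hz h => hgt z hz (Polynomial.root_mul.mpr (Or.inr h))) (-t)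
        (by linarith) ?_
      have : ((-t : ℝ) : ℂ) • (1 : Matrix (Fin d) (Fin d) ℂ) - ∑ i, (-ε i) • A i =
          -((t : ℂ) • (1 : Matrix (Fin d) (Fin d) ℂ) - ∑ i, ε i • A i) := by
        simp [sub_eq_add_neg, add_comm]
      rw [this, Matrix.det_neg, hdet, mul_zero]
    · by_contra hlt
      exact hb₁ w.re (fun z hz h => hgt z hz (Polynomial.root_mul.mpr (Or.inl h))) t
        (not_le.mp hlt) hdet
  have hherm : (∑ i, ε i • A i).IsHermitian := by
    simp only [Matrix.IsHermitian, Matrix.conjTranspose_sum, Matrix.conjTranspose_smul,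
      (hA _).isHermitian.eq, star_trivial]
  -- As d ≥ 1 there is an eigenvalue, so the interval [-r, r] is nonempty.
  have hwnonneg : 0 ≤ w.re := by
    have : Nonempty (Fin d) := ⟨⟨0, hd⟩⟩
    have hmem := hherm.eigenvalues_mem_spectrum_real ⟨0, hd⟩
    have := hspec _ hmem
    linarith
  refine ⟨w.re, ⟨hne, ?_, fun z hz => ⟨hreal z hz, hmax z ((hroot z).mp hz)⟩⟩,
    Matrix.norm_toEuclideanCLM_le_of_spectrum hherm hwnonneg hspec, hspec⟩
  rw [hw']
  exact (hroot w).mpr hw
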